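/- Consider the call-by-value simply typed $\lambda$-calculus with recursion, Booleans and symbols. Its types are $\tau ::= b \mid \tau_1\to\tau_2 \mid \mathsf{sym}$ with base types $b ::= \mathsf{unit}\mid\mathsf{bool}$, and its expressions are $$M ::= \mathsf{fail} \mid () \mid \mathsf{true}\mid\mathsf{false}\mid x \mid \lambda x.M \mid M_1M_2 \mid Y(\lambda f.\lambda x.M) \mid \mathsf{if}\ M_0\ \mathsf{then}\ M_1\ \mathsf{else}\ M_2 \mid \mathsf{gensym} \mid M_1 = M_2 \mid \ell,$$ where $\ell$ ranges over a denumerable set of labels (symbols) that appear only at run time and have no typing rule. The typing rules are the standard ones of the simply typed $\lambda$-calculus, with $\Gamma\vdash\mathsf{fail}:\tau$ for every $\tau$; $\Gamma\vdash Y(\lambda f.\lambda x.M):\tau_1\to\tau_2$ if $\Gamma,f:\tau_1\to\tau_2,x:\tau_1\vdash M:\tau_2$; $\Gamma\vdash\mathsf{gensym}:\mathsf{sym}$; and $\Gamma\vdash M_1=M_2:\mathsf{bool}$ if $\Gamma\vdash M_1:\mathsf{sym}$ and $\Gamma\vdash M_2:\mathsf{sym}$. Values are $V ::= ()\mid\mathsf{true}\mid\mathsf{false}\mid\lambda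 x.M\mid\ell$, evaluation contexts are $E ::= [\,]\mid E\,M\mid V\,E\mid \mathsf{if}\ E\ \mathsf{then}\ M_1\ \mathsf{else}\ M_2\mid E=M\mid \ell=E$, and reduction $\longrightarrow$ is given by $$\begin{aligned} &E[(\lambda x.M)V]\longrightarrow E[[V/x]M], \qquad E[\mathsf{fail}]\longrightarrow\mathsf{fail},\\ &E[\mathsf{if}\ \mathsf{true}\ \mathsf{then}\ M_1\ \mathsf{else}\ M_2]\longrightarrow E[M_1],\qquad E[\mathsf{if}\ \mathsf{false}\ \mathsf{then}\ M_1\ \mathsf{else}\ M_2]\longrightarrow E[M_2],\\ &E[Y(\lambda f.\lambda x.M)]\longrightarrow E[\lambda x.[Y(\lambda f.\lambda x.M)/f]M],\\ &E[\mathsf{gensym}]\longrightarrow E[\ell]\ \text{ if $\ell$ does not occur in $E$},\\ &E[\ell=\ell]\longrightarrow E[\mathsf{true}],\qquad E[\ell_1=\ell_2]\longrightarrow E[\mathsf{false}]\ \text{ if }\ell_1\neq\ell_2. \end{aligned}$$ Let $\longrightarrow^*$ be the reflexive transitive closure of $\longrightarrow$. **Theorem.** The reachability problem for this language is undecidable: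 there is no algorithm (partial recursive function on codes of expressions) that, given any closed expression $M$ with $\vdash M:b$ for some base type $b$, terminates and answers correctly whether $M\longrightarrow^*\mathsf{fail}$. -/

import Mathlib

namespace BPCFL

/-- Base types. -/
inductive BaseTy : Type
  | unit
  | bool

/-- Simple types: base types, function types and the type of symbols. -/
inductive Ty : Type
  | base (b : BaseTy)
  | arrow (σ τ : Ty)
  | sym

/-- Expressions, with de Bruijn indices for variables.
`lam M` is `λx. M`, where `x` is index `0` in `M`.
`fix M` is the recursive function `Y(λf. λx. M)`, where `x` is index `0` and `f` is index `1` in `M`.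
`label l` is a run-time symbol, drawn from the denumerable set `ℕ` of labels; it has no typing rule,
so it does not occur in a well-typed program. -/
inductive Tm : Type
  | fail
  | unit
  | bool (b : Bool)
  | var (n : ℕ)
  | lam (M : Tm)
  | app (M N : Tm)
  | fix (M : Tm)
  | cond (M₀ M₁ M₂ : Tm)
  | gensym
  | symEq (M N : Tm)
  | label (l : ℕ)

/-- The typing judgement `Γ ⊢ M : τ`; the type of variable `n` is the `n`-th entry of `Γ`. -/
inductive Typed : List Ty → Tm → Ty → Prop
  | fail {Γ : List Ty} {τ : Ty} : Typed Γ Tm.fail τ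
  | unit {Γ : List Ty} : Typed Γ Tm.unit (Ty.base BaseTy.unit)
  | bool {Γ : List Ty} {b : Bool} : Typed Γ (Tm.bool b) (Ty.base BaseTy.bool)
  | var {Γ : List Ty} {n : ℕ} {τ : Ty} : Γ[n]? = some τ → Typed Γ (Tm.var n) τ
  | lam {Γ : List Ty} {M : Tm} {σ τ : Ty} :
      Typed (σ :: Γ) M τ → Typed Γ (Tm.lam M) (Ty.arrow σ τ)
  | app {Γ : List Ty} {M N : Tm} {σ τ : Ty} :
      Typed Γ M (Ty.arrow σ τ) → Typed Γ N σ → Typed Γ (Tm.app M N) τ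
  | fix {Γ : List Ty} {M : Tm} {σ τ : Ty} :
      Typed (σ :: Ty.arrow σ τ :: Γ) M τ → Typed Γ (Tm.fix M) (Ty.arrow σ τ)
  | cond {Γ : List Ty} {M₀ M₁ M₂ : Tm} {τ : Ty} :
      Typed Γ M₀ (Ty.base BaseTy.bool) → Typed Γ M₁ τ → Typed Γ M₂ τ →
      Typed Γ (Tm.cond M₀ M₁ M₂) τ
  | gensym {Γ : List Ty} : Typed Γ Tm.gensym Ty.sym
  | symEq {Γ : List Ty} {M N : Tm} :
      Typed Γ M Ty.sym → Typed Γ N Ty.sym → Typed Γ (Tm.symEq M N) (Ty.base BaseTy.bool)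

/-- Lift a renaming of variables under one binder. -/
def upRen (ρ : ℕ → ℕ) : ℕ → ℕ
  | 0 => 0
  | n + 1 => ρ n + 1

/-- Renaming of the free variables. -/
def Tm.rename : (ℕ → ℕ) → Tm → Tm
  | _, .fail => .fail
  | _, .unit => .unit
  | _, .bool b => .bool b
  | ρ, .var n => .var (ρ n)
  | ρ, .lam M => .lam (M.rename (upRen ρ))
  | ρ, .app M N => .app (M.rename ρ) (N.rename ρ)
  | ρ, .fix M => .fix (M.rename (upRen (upRen ρ)))
  | ρ, .cond M₀ M₁ M₂ => .cond (M₀.rename ρ) (M₁.rename ρ) (M₂.rename ρ)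
  | _, .gensym => .gensym
  | ρ, .symEq M N => .symEq (M.rename ρ) (N.rename ρ)
  | _, .label l => .label l

/-- Lift a parallel substitution under one binder. -/
def upSub (σ : ℕ → Tm) : ℕ → Tm
  | 0 => .var 0
  | n + 1 => (σ n).rename Nat.succ

/-- Capture-avoiding parallel substitution. -/
def Tm.subst : (ℕ → Tm) → Tm → Tm
  | _, .fail => .fail
  | _, .unit => .unit
  | _, .bool b => .bool b
  | σ, .var n => σ n
  | σ, .lam M => .lam (M.subst (upSub σ))
  | σ, .app M N => .app (M.subst σ) (N.subst σ)
  | σ, .fix M => .fix (M.subst (upSub (upSub σ)))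
  | σ, .cond M₀ M₁ M₂ => .cond (M₀.subst σ) (M₁.subst σ) (M₂.subst σ)
  | _, .gensym => .gensym
  | σ, .symEq M N => .symEq (M.subst σ) (N.subst σ)
  | _, .label l => .label l

/-- The substitution that replaces variable `0` by `N` and lowers the other variables. -/
def single (N : Tm) : ℕ → Tm
  | 0 => N
  | n + 1 => .var n

/-- `M.inst N` is `[N/x]M`, where `x` is the variable with index `0` in `M`. -/
def Tm.inst (M N : Tm) : Tm :=
  M.subst (single N)

/-- Values. -/
inductive IsValue : Tm → Prop
  | unit : IsValue Tm.unit
  | bool (b : Bool) : IsValue (Tm.bool b)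
  | lam (M : Tm) : IsValue (Tm.lam M)
  | label (l : ℕ) : IsValue (Tm.label l)

/-- Call-by-value evaluation contexts
`E ::= [] | E M | V E | if E then M₁ else M₂ | E = M | l = E`. -/
inductive ECtx : Type
  | hole
  | appL (E : ECtx) (M : Tm)
  | appR (V : Tm) (hV : IsValue V) (E : ECtx)
  | cond (E : ECtx) (M₁ M₂ : Tm)
  | symEqL (E : ECtx) (M : Tm)
  | symEqR (l : ℕ) (E : ECtx)

/-- `E.plug M` is `E[M]`. -/
def ECtx.plug : ECtx → Tm → Tm
  | .hole, N => N
  | .appL E M, N => .app (E.plug N) M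
  | .appR V _ E, N => .app V (E.plug N)
  | .cond E M₁ M₂, N => .cond (E.plug N) M₁ M₂
  | .symEqL E M, N => .symEq (E.plug N) M
  | .symEqR l E, N => .symEq (.label l) (E.plug N)

/-- The label `l` occurs in an expression. -/
def Tm.Occurs (l : ℕ) : Tm → Prop
  | .fail => False
  | .unit => False
  | .bool _ => False
  | .var _ => False
  | .lam M => M.Occurs l
  | .app M N => M.Occurs l ∨ N.Occurs l
  | .fix M => M.Occurs l
  | .cond M₀ M₁ M₂ => M₀.Occurs l ∨ M₁.Occurs l ∨ M₂.Occurs l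
  | .gensym => False
  | .symEq M N => M.Occurs l ∨ N.Occurs l
  | .label k => k = l

/-- The label `l` occurs in an evaluation context. -/
def ECtx.Occurs (l : ℕ) : ECtx → Prop
  | .hole => False
  | .appL E M => E.Occurs l ∨ M.Occurs l
  | .appR V _ E => V.Occurs l ∨ E.Occurs l
  | .cond E M₁ M₂ => E.Occurs l ∨ M₁.Occurs l ∨ M₂.Occurs l
  | .symEqL E M => E.Occurs l ∨ M.Occurs l
  | .symEqR k E => k = l ∨ E.Occurs l

/-- The one-step reduction relation. In the rule `fix`, the term `(Tm.lam M).inst (Tm.fix M)` is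
`λx. [Y(λf. λx. M)/f]M`. -/
inductive Red : Tm → Tm → Prop
  | beta (E : ECtx) (M V : Tm) (hV : IsValue V) :
      Red (E.plug (Tm.app (Tm.lam M) V)) (E.plug (M.inst V))
  | condTrue (E : ECtx) (M₁ M₂ : Tm) :
      Red (E.plug (Tm.cond (Tm.bool true) M₁ M₂)) (E.plug M₁)
  | condFalse (E : ECtx) (M₁ M₂ : Tm) :
      Red (E.plug (Tm.cond (Tm.bool false) M₁ M₂)) (E.plug M₂)
  | fail (E : ECtx) : Red (E.plug Tm.fail) Tm.fail
  | fix (E : ECtx) (M : Tm) :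
      Red (E.plug (Tm.fix M)) (E.plug ((Tm.lam M).inst (Tm.fix M)))
  | gensym (E : ECtx) (l : ℕ) (hl : ¬ E.Occurs l) :
      Red (E.plug Tm.gensym) (E.plug (Tm.label l))
  | symEqTrue (E : ECtx) (l : ℕ) :
      Red (E.plug (Tm.symEq (Tm.label l) (Tm.label l))) (E.plug (Tm.bool true))
  | symEqFalse (E : ECtx) (l₁ l₂ : ℕ) (h : l₁ ≠ l₂) :
      Red (E.plug (Tm.symEq (Tm.label l₁) (Tm.label l₂))) (E.plug (Tm.bool false))

/-- `M` reduces in zero or more steps to `fail`. -/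
def ReachesFail (M : Tm) : Prop :=
  Relation.ReflTransGen Red M Tm.fail

/-- A Gödel numbering of expressions: a constructor tag paired with the codes of the arguments. -/
def Tm.code : Tm → ℕ
  | .fail => Nat.pair 0 0
  | .unit => Nat.pair 1 0
  | .bool b => Nat.pair 2 b.toNat
  | .var n => Nat.pair 3 n
  | .lam M => Nat.pair 4 M.code
  | .app M N => Nat.pair 5 (Nat.pair M.code N.code)
  | .fix M => Nat.pair 6 M.code
  | .cond M₀ M₁ M₂ => Nat.pair 7 (Nat.pair M₀.code (Nat.pair M₁.code M₂.code))
  | .gensym => Nat.pair 8 0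
  | .symEq M N => Nat.pair 9 (Nat.pair M.code N.code)
  | .label l => Nat.pair 10 l

theorem Tm.code_injective : Function.Injective Tm.code := by
  intro M
  induction M <;> intro N h <;> cases N <;> simp_all [Tm.code, Nat.pair_eq_pair]
  case bool.bool a b => cases a <;> cases b <;> simp_all
  all_goals grind

/-- The partial function `f` solves the reachability problem: on (the code of) every closed
expression `M` of base type, `f` terminates, and answers `true` exactly if `M` reduces to `fail`.
Nothing is required of `f` on other inputs. -/
def SolvesReachability (f : ℕ →. Bool) : Prop :=
  ∀ (M : Tm) (b : BaseTy), Typed [] M (Ty.base b) →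
    ∃ r ∈ f M.code, (r = true ↔ ReachesFail M)

end BPCFL

/-! The base types are finite, so unbounded data has to come from fresh symbols and functions. A
function of type `heapTy` can be extended at a fresh symbol by testing its argument against that
symbol, which gives a growing heap of cons cells. Natural numbers and lists of them are stored there
by pointers, and every program has the same simple type `progTy`. Programs in continuation-passing
style over such heaps simulate all of `Turing.ToPartrec.Code`, with `Tm.fix` supplying the
iteration.

Reduction is deterministic apart from the choice of fresh symbols. Unique decomposition
(`IsRedex.plug_inj`) shows that contracting any other redex in an evaluation context, `fail` aside,
preserves and reflects reachability of `fail`, so expressions may be rewritten along `FailEquiv`.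
The choice of symbol is handled by `reachesFail_let_gensym`: if the continuation has the same answer
`P` for all fresh symbols, so does the whole expression. This is why `Computes` carries an arbitrary
proposition `P` through the continuation.

Simulation is proved for terminating runs only (`compile_computes`); divergence need never be
analysed. A decider would answer on every well-typed input, hence yield a total computable 0-1
function. A diagonal function, compiled once, disagrees with that function at its own code, and at
that point the diagonal function is defined, so the simulation applies and contradicts the answer.
-/

namespace BPCFL

/-! ### Unique decomposition and equivalence with respect to reachability of `fail` -/

/-- Contraction of the redexes whose result is unique and that do not discard the context. -/
inductive Contracts : Tm → Tm → Prop
  | beta (M V : Tm) (hV : IsValue V) : Contracts (.app (.lam M) V) (M.inst V)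
  | condTrue (M₁ M₂ : Tm) : Contracts (.cond (.bool true) M₁ M₂) M₁
  | condFalse (M₁ M₂ : Tm) : Contracts (.cond (.bool false) M₁ M₂) M₂
  | fix (M : Tm) : Contracts (.fix M) ((Tm.lam M).inst (.fix M))
  | symEqTrue (l : ℕ) : Contracts (.symEq (.label l) (.label l)) (.bool true)
  | symEqFalse (l₁ l₂ : ℕ) (h : l₁ ≠ l₂) :
      Contracts (.symEq (.label l₁) (.label l₂)) (.bool false)

/-- Redexes. -/
inductive IsRedex : Tm → Prop
  | contracts {M N : Tm} (h : Contracts M N) : IsRedex M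
  | fail : IsRedex .fail
  | gensym : IsRedex .gensym

theorem IsRedex.not_isValue {r : Tm} (h : IsRedex r) : ¬ IsValue r := by
  intro hv
  cases hv <;> cases h <;> rename_i h <;> cases h

theorem IsRedex.plug_not_isValue {r : Tm} (h : IsRedex r) (E : ECtx) : ¬ IsValue (E.plug r) := by
  cases E with
  | hole => exact h.not_isValue
  | _ => intro hv; cases hv

/-- A subterm of a redex that occupies a hole position other than the root is already a value,
whereas a context filled with a redex never is. -/
theorem IsRedex.eq_hole {r r' : Tm} (h : IsRedex r) (h' : IsRedex r') {E : ECtx}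
    (e : r = E.plug r') : E = .hole := by
  have key : ∀ E' : ECtx, ¬ IsValue (E'.plug r') := h'.plug_not_isValue
  cases E with
  | hole => rfl
  | appL E _ | appR _ _ E | cond E _ _ | symEqL E _ | symEqR _ E =>
    have hE := key E
    simp only [ECtx.plug] at e
    generalize E.plug r' = X at e hE
    subst e
    cases h with | contracts h
    cases h <;> exact absurd (by first | assumption | constructor) hE

/-- Unique decomposition. Two contexts can diverge only where one goes into the left operand and the
other requires a value there; a context filled with a redex is not a value. -/
theorem IsRedex.plug_inj {r r' : Tm} (h : IsRedex r) (h' : IsRedex r') {E E' : ECtx}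
    (e : E.plug r = E'.plug r') : E = E' ∧ r = r' := by
  have k := h.plug_not_isValue
  have k' := h'.plug_not_isValue
  induction E generalizing E' with
  | hole =>
    have := h.eq_hole h' e
    subst this
    exact ⟨rfl, e⟩
  | appL E M ih =>
    cases E' with
    | hole => exact absurd (h'.eq_hole h e.symm) (by simp)
    | appL E' M' =>
      simp only [ECtx.plug, Tm.app.injEq] at e
      obtain ⟨rfl, rfl⟩ := ih e.1
      exact ⟨by rw [e.2], rfl⟩
    | appR V hV E' =>
      simp only [ECtx.plug, Tm.app.injEq] at e
      exact absurd (e.1 ▸ hV) (k E)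
    | _ => simp [ECtx.plug] at e
  | appR V hV E ih =>
    cases E' with
    | hole => exact absurd (h'.eq_hole h e.symm) (by simp)
    | appL E' M' =>
      simp only [ECtx.plug, Tm.app.injEq] at e
      exact absurd (e.1 ▸ hV) (k' E')
    | appR V' hV' E' =>
      simp only [ECtx.plug, Tm.app.injEq] at e
      obtain ⟨rfl, rfl⟩ := ih e.2
      obtain ⟨rfl, -⟩ := e
      exact ⟨rfl, rfl⟩
    | _ => simp [ECtx.plug] at e
  | cond E M₁ M₂ ih =>
    cases E' with
    | hole => exact absurd (h'.eq_hole h e.symm) (by simp)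
    | cond E' M₁' M₂' =>
      simp only [ECtx.plug, Tm.cond.injEq] at e
      obtain ⟨rfl, rfl⟩ := ih e.1
      exact ⟨by rw [e.2.1, e.2.2], rfl⟩
    | _ => simp [ECtx.plug] at e
  | symEqL E M ih =>
    cases E' with
    | hole => exact absurd (h'.eq_hole h e.symm) (by simp)
    | symEqL E' M' =>
      simp only [ECtx.plug, Tm.symEq.injEq] at e
      obtain ⟨rfl, rfl⟩ := ih e.1
      exact ⟨by rw [e.2], rfl⟩
    | symEqR l E' =>
      simp only [ECtx.plug, Tm.symEq.injEq] at e
      exact absurd (e.1 ▸ IsValue.label l) (k E)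
    | _ => simp [ECtx.plug] at e
  | symEqR l E ih =>
    cases E' with
    | hole => exact absurd (h'.eq_hole h e.symm) (by simp)
    | symEqL E' M' =>
      simp only [ECtx.plug, Tm.symEq.injEq] at e
      exact absurd (e.1 ▸ IsValue.label l) (k' E')
    | symEqR l' E' =>
      simp only [ECtx.plug, Tm.symEq.injEq, Tm.label.injEq] at e
      obtain ⟨rfl, rfl⟩ := ih e.2
      exact ⟨by rw [e.1], rfl⟩
    | _ => simp [ECtx.plug] at e

/-- Every reduction step contracts a redex in an evaluation context. -/
theorem Red.cases_redex {M N : Tm} (h : Red M N) :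
    (∃ E r r', Contracts r r' ∧ M = ECtx.plug E r ∧ N = E.plug r') ∨
    (∃ E, M = ECtx.plug E .fail ∧ N = .fail) ∨
    (∃ E l, ¬ ECtx.Occurs l E ∧ M = E.plug .gensym ∧ N = E.plug (.label l)) := by
  cases h with
  | beta E M V hV => exact .inl ⟨E, _, _, .beta M V hV, rfl, rfl⟩
  | condTrue E _ M₂ => exact .inl ⟨E, _, _, .condTrue _ M₂, rfl, rfl⟩
  | condFalse E M₁ _ => exact .inl ⟨E, _, _, .condFalse M₁ _, rfl, rfl⟩
  | fail E => exact .inr (.inl ⟨E, rfl, rfl⟩)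
  | fix E M => exact .inl ⟨E, _, _, .fix M, rfl, rfl⟩
  | gensym E l hl => exact .inr (.inr ⟨E, l, hl, rfl, rfl⟩)
  | symEqTrue E l => exact .inl ⟨E, _, _, .symEqTrue l, rfl, rfl⟩
  | symEqFalse E l₁ l₂ h => exact .inl ⟨E, _, _, .symEqFalse l₁ l₂ h, rfl, rfl⟩

theorem Contracts.red {r r' : Tm} (h : Contracts r r') (E : ECtx) :
    Red (E.plug r) (E.plug r') := by
  cases h with
  | beta M V hV => exact .beta E M V hV
  | condTrue _ M₂ => exact .condTrue E _ M₂
  | condFalse M₁ _ => exact .condFalse E M₁ _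
  | fix M => exact .fix E M
  | symEqTrue l => exact .symEqTrue E l
  | symEqFalse l₁ l₂ h => exact .symEqFalse E l₁ l₂ h

theorem Contracts.unique {r r₁ r₂ : Tm} (h₁ : Contracts r r₁) (h₂ : Contracts r r₂) :
    r₁ = r₂ := by
  cases h₁ <;> cases h₂ <;> first | rfl | contradiction

theorem Contracts.eq_of_red {r r' N : Tm} (h : Contracts r r') {E : ECtx}
    (hN : Red (E.plug r) N) : N = E.plug r' := by
  rcases hN.cases_redex with ⟨E', s, s', hs, e, rfl⟩ | ⟨E', e, rfl⟩ | ⟨E', l, -, e, rfl⟩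
  · obtain ⟨rfl, rfl⟩ := IsRedex.plug_inj (.contracts h) (.contracts hs) e
    rw [h.unique hs]
  · obtain ⟨rfl, rfl⟩ := IsRedex.plug_inj (.contracts h) .fail e
    cases h
  · obtain ⟨rfl, rfl⟩ := IsRedex.plug_inj (.contracts h) .gensym e
    cases h

theorem not_reachesFail_unit : ¬ ReachesFail .unit := by
  intro h
  rcases Relation.ReflTransGen.cases_head h with h | ⟨N, h, -⟩
  · cases h
  · have k : IsValue .unit := .unit
    rcases h.cases_redex with ⟨E, r, r', hr, e, -⟩ | ⟨E, e, -⟩ | ⟨E, l, -, e, -⟩ <;> rw [e] at k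
    · exact IsRedex.plug_not_isValue (.contracts hr) E k
    · exact IsRedex.plug_not_isValue .fail E k
    · exact IsRedex.plug_not_isValue .gensym E k

/-- `M` and `N` behave alike, with respect to reaching `fail`, in all evaluation contexts. -/
def FailEquiv (M N : Tm) : Prop :=
  ∀ E : ECtx, ReachesFail (E.plug M) ↔ ReachesFail (E.plug N)

/-- One direction prepends a step. For the other, the first step of any run is forced by unique
decomposition, and an empty run would make the redex `fail` itself. `gensym` is left out of
`Contracts` because its result is not unique. -/
theorem Contracts.failEquiv {r r' : Tm} (h : Contracts r r') : FailEquiv r r' := by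
  intro E
  refine ⟨fun hf => ?_, fun hf => .head (h.red E) hf⟩
  rcases Relation.ReflTransGen.cases_head hf with e | ⟨N, hN, hf⟩
  · obtain ⟨-, rfl⟩ := IsRedex.plug_inj (E' := .hole) (.contracts h) .fail e
    cases h
  · rwa [h.eq_of_red hN] at hf

namespace FailEquiv

theorem refl (M : Tm) : FailEquiv M M := fun _ => Iff.rfl

theorem trans {M N P : Tm} (h : FailEquiv M N) (h' : FailEquiv N P) : FailEquiv M P :=
  fun E => (h E).trans (h' E)

theorem symm {M N : Tm} (h : FailEquiv M N) : FailEquiv N M := fun E => (h E).symm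

theorem iff {M N : Tm} (h : FailEquiv M N) : ReachesFail M ↔ ReachesFail N :=
  h .hole

end FailEquiv

/-- Composition of evaluation contexts. -/
def ECtx.comp : ECtx → ECtx → ECtx
  | .hole, F => F
  | .appL E M, F => .appL (E.comp F) M
  | .appR V hV E, F => .appR V hV (E.comp F)
  | .cond E M₁ M₂, F => .cond (E.comp F) M₁ M₂
  | .symEqL E M, F => .symEqL (E.comp F) M
  | .symEqR l E, F => .symEqR l (E.comp F)

theorem ECtx.plug_comp (E F : ECtx) (M : Tm) : (E.comp F).plug M = E.plug (F.plug M) := by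
  induction E <;> simp_all [ECtx.comp, ECtx.plug]

namespace FailEquiv

theorem plug {M N : Tm} (h : FailEquiv M N) (F : ECtx) : FailEquiv (F.plug M) (F.plug N) := by
  intro E
  rw [← ECtx.plug_comp, ← ECtx.plug_comp]
  exact h _

theorem appL {M N : Tm} (h : FailEquiv M N) (P : Tm) : FailEquiv (.app M P) (.app N P) :=
  h.plug (.appL .hole P)

theorem appR {M N : Tm} (h : FailEquiv M N) {V : Tm} (hV : IsValue V) :
    FailEquiv (.app V M) (.app V N) :=
  h.plug (.appR V hV .hole)

/-- An argument is in evaluation position only once the function is a value. So the function is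
evaluated to `V`, the argument exchanged, and the evaluation of the function undone. -/
theorem appR_of_isValue {M N : Tm} (h : FailEquiv M N) {F V : Tm} (hF : FailEquiv F V)
    (hV : IsValue V) : FailEquiv (.app F M) (.app F N) :=
  ((hF.appL M).trans (h.appR hV)).trans (hF.appL N).symm

theorem cond {M N : Tm} (h : FailEquiv M N) (P Q : Tm) :
    FailEquiv (.cond M P Q) (.cond N P Q) :=
  h.plug (.cond .hole P Q)

theorem symEq {M N : Tm} {l l' : ℕ} (h : FailEquiv M (.label l)) (h' : FailEquiv N (.label l')) :
    FailEquiv (.symEq M N) (.bool (decide (l = l'))) := by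
  refine (h.plug (.symEqL .hole N)).trans ((h'.plug (.symEqR l .hole)).trans ?_)
  by_cases e : l = l'
  · subst e
    simpa using! (Contracts.symEqTrue l).failEquiv
  · simpa [e] using! (Contracts.symEqFalse l l' e).failEquiv

theorem cond_bool (b : Bool) (P Q : Tm) : FailEquiv (.cond (.bool b) P Q) (bif b then P else Q) := by
  cases b
  · exact (Contracts.condFalse P Q).failEquiv
  · exact (Contracts.condTrue P Q).failEquiv

theorem beta (M : Tm) {V : Tm} (hV : IsValue V) : FailEquiv (.app (.lam M) V) (M.inst V) :=
  (Contracts.beta M V hV).failEquiv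

theorem beta₂ (M : Tm) {V W : Tm} (hV : IsValue V) (hW : IsValue W) :
    FailEquiv (.app (.app (.lam (.lam M)) V) W)
      ((M.subst (upSub (single V))).subst (single W)) :=
  ((beta _ hV).appL _).trans (beta _ hW)

theorem beta₃ (M : Tm) {V W X : Tm} (hV : IsValue V) (hW : IsValue W) (hX : IsValue X) :
    FailEquiv (.app (.app (.app (.lam (.lam (.lam M))) V) W) X)
      (((M.subst (upSub (upSub (single V)))).subst (upSub (single W))).subst (single X)) :=
  ((beta₂ _ hV hW).appL _).trans (beta _ hX)

theorem beta₄ (M : Tm) {V W X Y : Tm} (hV : IsValue V) (hW : IsValue W) (hX : IsValue X)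
    (hY : IsValue Y) :
    FailEquiv (.app (.app (.app (.app (.lam (.lam (.lam (.lam M)))) V) W) X) Y)
      ((((M.subst (upSub (upSub (upSub (single V))))).subst (upSub (upSub (single W)))).subst
        (upSub (single X))).subst (single Y)) :=
  ((beta₃ _ hV hW hX).appL _).trans (beta _ hY)

end FailEquiv

/-! ### Fresh symbols -/

theorem Tm.exists_bound_occurs (M : Tm) : ∃ n, ∀ l, M.Occurs l → l < n := by
  induction M with
  | lam M ih => exact ih
  | fix M ih => exact ih
  | app M N ih₁ ih₂ =>
    obtain ⟨a, ha⟩ := ih₁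
    obtain ⟨b, hb⟩ := ih₂
    exact ⟨max a b, fun l h => by rcases h with h | h <;> simp [ha, hb, h]⟩
  | symEq M N ih₁ ih₂ =>
    obtain ⟨a, ha⟩ := ih₁
    obtain ⟨b, hb⟩ := ih₂
    exact ⟨max a b, fun l h => by rcases h with h | h <;> simp [ha, hb, h]⟩
  | cond M N P ih₁ ih₂ ih₃ =>
    obtain ⟨a, ha⟩ := ih₁
    obtain ⟨b, hb⟩ := ih₂
    obtain ⟨c, hc⟩ := ih₃
    exact ⟨max a (max b c), fun l h => by rcases h with h | h | h <;> simp [ha, hb, hc, h]⟩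
  | label k => exact ⟨k + 1, fun l h => by simp only [Tm.Occurs] at h; omega⟩
  | _ => exact ⟨0, fun l h => h.elim⟩

/-- Running `let x = gensym in N`: if all fresh symbols lead to the same answer, so does the
expression. -/
theorem reachesFail_let_gensym {N : Tm} {P : Prop}
    (h : ∀ l, ¬ N.Occurs l → (ReachesFail (N.inst (.label l)) ↔ P)) :
    ReachesFail (.app (.lam N) .gensym) ↔ P := by
  have hplug : Tm.app (.lam N) .gensym = (ECtx.appR (.lam N) (.lam N) .hole).plug .gensym := rfl
  constructor
  · intro hf
    rcases Relation.ReflTransGen.cases_head hf with e | ⟨M, hM, hf⟩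
    · cases e
    · rw [hplug] at hM
      rcases hM.cases_redex with ⟨E, r, r', hr, e, -⟩ | ⟨E, e, -⟩ | ⟨E, l, hl, e, rfl⟩
      · obtain ⟨-, rfl⟩ := IsRedex.plug_inj .gensym (.contracts hr) e
        cases hr
      · exact absurd (IsRedex.plug_inj .gensym .fail e).2 (by simp)
      · obtain ⟨rfl, -⟩ := IsRedex.plug_inj .gensym .gensym e
        -- Freshness for the context includes freshness for the body `N`, which is the function part
        -- of that context.
        rw [← h l (fun ho => hl (.inl ho))]
        exact (FailEquiv.beta N (.label l)).iff.1 hf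
  · intro hP
    obtain ⟨n, hn⟩ := N.exists_bound_occurs
    have hfresh : ¬ N.Occurs n := fun ho => lt_irrefl n (hn n ho)
    refine .head (hplug ▸ Red.gensym _ n ?_) ((FailEquiv.beta N (.label n)).iff.2 ((h n hfresh).2 hP))
    simpa [ECtx.Occurs] using! hfresh

/-! ### Closed expressions -/

/-- The free variables of `M` are below `k`. -/
def Tm.ClosedAt : ℕ → Tm → Prop
  | k, .var n => n < k
  | k, .lam M => M.ClosedAt (k + 1)
  | k, .app M N => M.ClosedAt k ∧ N.ClosedAt k
  | k, .fix M => M.ClosedAt (k + 2)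
  | k, .cond M₀ M₁ M₂ => M₀.ClosedAt k ∧ M₁.ClosedAt k ∧ M₂.ClosedAt k
  | k, .symEq M N => M.ClosedAt k ∧ N.ClosedAt k
  | _, _ => True

theorem upRen_eq {ρ : ℕ → ℕ} {k : ℕ} (h : ∀ n < k, ρ n = n) : ∀ n < k + 1, upRen ρ n = n
  | 0, _ => rfl
  | n + 1, hn => by simp [upRen, h n (by omega)]

theorem upSub_eq {σ : ℕ → Tm} {k : ℕ} (h : ∀ n < k, σ n = .var n) :
    ∀ n < k + 1, upSub σ n = .var n
  | 0, _ => rfl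
  | n + 1, hn => by simp [upSub, h n (by omega), Tm.rename]

theorem Tm.ClosedAt.rename_eq {M : Tm} {k : ℕ} (hM : M.ClosedAt k) {ρ : ℕ → ℕ}
    (h : ∀ n < k, ρ n = n) : M.rename ρ = M := by
  induction M generalizing k ρ with
  | var n => simp [Tm.rename, h n hM]
  | lam M ih => simp [Tm.rename, ih hM (upRen_eq h)]
  | fix M ih => simp [Tm.rename, ih hM (upRen_eq (upRen_eq h))]
  | app M N ih₁ ih₂ => simp [Tm.rename, ih₁ hM.1 h, ih₂ hM.2 h]
  | symEq M N ih₁ ih₂ => simp [Tm.rename, ih₁ hM.1 h, ih₂ hM.2 h]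
  | cond M N P ih₁ ih₂ ih₃ => simp [Tm.rename, ih₁ hM.1 h, ih₂ hM.2.1 h, ih₃ hM.2.2 h]
  | _ => rfl

theorem Tm.ClosedAt.subst_eq {M : Tm} {k : ℕ} (hM : M.ClosedAt k) {σ : ℕ → Tm}
    (h : ∀ n < k, σ n = .var n) : M.subst σ = M := by
  induction M generalizing k σ with
  | var n => simp [Tm.subst, h n hM]
  | lam M ih => simp [Tm.subst, ih hM (upSub_eq h)]
  | fix M ih => simp [Tm.subst, ih hM (upSub_eq (upSub_eq h))]
  | app M N ih₁ ih₂ => simp [Tm.subst, ih₁ hM.1 h, ih₂ hM.2 h]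
  | symEq M N ih₁ ih₂ => simp [Tm.subst, ih₁ hM.1 h, ih₂ hM.2 h]
  | cond M N P ih₁ ih₂ ih₃ => simp [Tm.subst, ih₁ hM.1 h, ih₂ hM.2.1 h, ih₃ hM.2.2 h]
  | _ => rfl

theorem Tm.ClosedAt.mono {M : Tm} {k k' : ℕ} (hM : M.ClosedAt k) (h : k ≤ k') :
    M.ClosedAt k' := by
  induction M generalizing k k' with
  | var n => exact lt_of_lt_of_le hM h
  | lam M ih => exact ih hM (by omega)
  | fix M ih => exact ih hM (by omega)
  | app M N ih₁ ih₂ => exact ⟨ih₁ hM.1 h, ih₂ hM.2 h⟩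
  | symEq M N ih₁ ih₂ => exact ⟨ih₁ hM.1 h, ih₂ hM.2 h⟩
  | cond M N P ih₁ ih₂ ih₃ => exact ⟨ih₁ hM.1 h, ih₂ hM.2.1 h, ih₃ hM.2.2 h⟩
  | _ => trivial

/-- Closed expressions. -/
def Tm.Closed (M : Tm) : Prop :=
  M.ClosedAt 0

theorem Tm.Closed.closedAt {M : Tm} (hM : M.Closed) (k : ℕ) : M.ClosedAt k :=
  hM.mono (Nat.zero_le k)

theorem Tm.Closed.rename {M : Tm} (hM : M.Closed) (ρ : ℕ → ℕ) : M.rename ρ = M :=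
  ClosedAt.rename_eq hM (by simp)

theorem Tm.Closed.subst {M : Tm} (hM : M.Closed) (σ : ℕ → Tm) : M.subst σ = M :=
  ClosedAt.subst_eq hM (by simp)

theorem Typed.closedAt {Γ : List Ty} {M : Tm} {τ : Ty} (h : Typed Γ M τ) :
    M.ClosedAt Γ.length := by
  induction h with
  | var h => exact (List.getElem?_eq_some_iff.1 h).1
  | lam _ ih => exact ih
  | fix _ ih => exact ih
  | app _ _ ih₁ ih₂ => exact ⟨ih₁, ih₂⟩
  | symEq _ _ ih₁ ih₂ => exact ⟨ih₁, ih₂⟩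
  | cond _ _ _ ih₁ ih₂ ih₃ => exact ⟨ih₁, ih₂, ih₃⟩
  | _ => trivial

theorem Typed.weaken {Γ : List Ty} {M : Tm} {τ : Ty} (h : Typed Γ M τ) (Δ : List Ty) :
    Typed (Γ ++ Δ) M τ := by
  induction h with
  | fail => exact .fail
  | unit => exact .unit
  | bool => exact .bool
  | gensym => exact .gensym
  | var h =>
    refine .var ?_
    rw [List.getElem?_append_left (List.getElem?_eq_some_iff.1 h).1, h]
  | lam _ ih => exact .lam ih
  | fix _ ih => exact .fix ih
  | app _ _ ih₁ ih₂ => exact .app ih₁ ih₂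
  | symEq _ _ ih₁ ih₂ => exact .symEq ih₁ ih₂
  | cond _ _ _ ih₁ ih₂ ih₃ => exact .cond ih₁ ih₂ ih₃

theorem Typed.of_nil {M : Tm} {τ : Ty} (h : Typed [] M τ) (Γ : List Ty) : Typed Γ M τ :=
  h.weaken Γ

/-! ### Heaps of cons cells

A heap is an expression that maps a symbol and a Boolean to one of the two components of the cell
that the symbol names. A cell both of whose components are its own name is the empty list and the
number `0`; other cells are pairs or, by their first component, successors. -/

/-- The type of heaps. -/
abbrev heapTy : Ty := .arrow .sym (.arrow (.base .bool) .sym)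

/-- The type of continuations, which take a symbol and a heap. -/
abbrev contTy : Ty := .arrow .sym (.arrow heapTy (.base .unit))

/-- The type of programs, which take a symbol, a heap and a continuation. -/
abbrev progTy : Ty := .arrow .sym (.arrow heapTy (.arrow contTy (.base .unit)))

/-- The value that represents a finite heap. -/
def heapTm : List (ℕ × ℕ × ℕ) → Tm
  | [] => .lam (.lam (.var 1))
  | (s, a, d) :: L => .lam (.lam (.cond (.symEq (.var 1) (.label s))
      (.cond (.var 0) (.label a) (.label d)) (.app (.app (heapTm L) (.var 1)) (.var 0))))

theorem heapTm_isValue (L : List (ℕ × ℕ × ℕ)) : IsValue (heapTm L) := by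
  cases L <;> exact .lam _

theorem heapTm_closed (L : List (ℕ × ℕ × ℕ)) : (heapTm L).Closed := by
  induction L with
  | nil => simp [heapTm, Tm.Closed, Tm.ClosedAt]
  | cons c L ih => simp [heapTm, Tm.Closed, Tm.ClosedAt, ih.closedAt]

@[simp]
theorem heapTm_subst (L : List (ℕ × ℕ × ℕ)) (σ : ℕ → Tm) : (heapTm L).subst σ = heapTm L :=
  (heapTm_closed L).subst σ

@[simp]
theorem heapTm_rename (L : List (ℕ × ℕ × ℕ)) (ρ : ℕ → ℕ) : (heapTm L).rename ρ = heapTm L :=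
  (heapTm_closed L).rename ρ

/-- Every key of the heap occurs as a label in the expression that represents it, so a fresh symbol
is never a key. -/
theorem lookup_eq_none_of_not_occurs {L : List (ℕ × ℕ × ℕ)} {l : ℕ}
    (h : ¬ (heapTm L).Occurs l) : L.lookup l = none := by
  induction L with
  | nil => rfl
  | cons c L ih =>
    obtain ⟨s, a, d⟩ := c
    simp only [heapTm, Tm.Occurs, not_or] at h
    have hs : (l == s) = false := by simpa using Ne.symm h.1.2
    rw [List.lookup_cons, hs]
    exact ih h.2.2.1.1

/-- The pointer `M` need only evaluate to a symbol, so lookups can be nested. The chain of equality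
tests follows `List.lookup`, the newest entry first. -/
theorem heapTm_lookup {L : List (ℕ × ℕ × ℕ)} {s a d : ℕ} (h : L.lookup s = some (a, d))
    {M : Tm} (hM : FailEquiv M (.label s)) (b : Bool) :
    FailEquiv (.app (.app (heapTm L) M) (.bool b)) (.label (bif b then a else d)) := by
  refine ((hM.appR (heapTm_isValue L)).appL _).trans ?_
  clear hM
  induction L with
  | nil => simp at h
  | cons c L ih =>
    obtain ⟨s', a', d'⟩ := c
    refine (FailEquiv.beta₂ _ (.label s) (.bool b)).trans ?_
    simp only [Tm.subst, upSub, single, Tm.rename, heapTm_subst]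
    refine ((FailEquiv.symEq (.refl _) (.refl _)).cond _ _).trans ((FailEquiv.cond_bool _ _ _).trans ?_)
    rw [List.lookup_cons] at h
    by_cases e : s = s'
    · subst e
      simp only [beq_self_eq_true, Option.some.injEq, Prod.mk.injEq] at h
      obtain ⟨rfl, rfl⟩ := h
      simp only [decide_true, cond_true]
      refine (FailEquiv.cond_bool _ _ _).trans ?_
      cases b <;> exact .refl _
    · simp only [beq_eq_false_iff_ne.2 e] at h
      simp only [e, decide_false, cond_false]
      exact ih h

/-- `s` represents the number `n` in the heap `L`. -/
def RepNat (L : List (ℕ × ℕ × ℕ)) : ℕ → ℕ → Prop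
  | 0, s => L.lookup s = some (s, s)
  | n + 1, s => ∃ a d, L.lookup s = some (a, d) ∧ a ≠ s ∧ RepNat L n a

/-- `s` represents the list `v` in the heap `L`. -/
def RepList (L : List (ℕ × ℕ × ℕ)) : List ℕ → ℕ → Prop
  | [], s => L.lookup s = some (s, s)
  | n :: v, s => ∃ a d, L.lookup s = some (a, d) ∧ RepNat L n a ∧ RepList L v d

/-- The heap `L'` extends `L`. -/
def HeapLE (L L' : List (ℕ × ℕ × ℕ)) : Prop :=
  ∀ s c, L.lookup s = some c → L'.lookup s = some c

theorem HeapLE.refl (L : List (ℕ × ℕ × ℕ)) : HeapLE L L := fun _ _ h => h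

theorem HeapLE.trans {L L' L'' : List (ℕ × ℕ × ℕ)} (h : HeapLE L L') (h' : HeapLE L' L'') :
    HeapLE L L'' :=
  fun s c e => h' s c (h s c e)

theorem HeapLE.cons {L : List (ℕ × ℕ × ℕ)} {s : ℕ} (h : L.lookup s = none) (c : ℕ × ℕ) :
    HeapLE L ((s, c) :: L) := by
  intro t e ht
  have : t ≠ s := by
    rintro rfl
    simp [h] at ht
  rw [List.lookup_cons, beq_eq_false_iff_ne.2 this]
  exact ht

theorem RepNat.mono {L L' : List (ℕ × ℕ × ℕ)} (h : HeapLE L L') {n s : ℕ} (hs : RepNat L n s) :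
    RepNat L' n s := by
  induction n generalizing s with
  | zero => exact h _ _ hs
  | succ n ih =>
    obtain ⟨a, d, e, hne, ha⟩ := hs
    exact ⟨a, d, h _ _ e, hne, ih ha⟩

theorem RepList.mono {L L' : List (ℕ × ℕ × ℕ)} (h : HeapLE L L') {v : List ℕ} {s : ℕ}
    (hs : RepList L v s) : RepList L' v s := by
  induction v generalizing s with
  | nil => exact h _ _ hs
  | cons n v ih =>
    obtain ⟨a, d, e, ha, hd⟩ := hs
    exact ⟨a, d, h _ _ e, ha.mono h, ih hd⟩

/-- The empty list is a cell pointing to itself, and the same cell represents zero. Reading its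
components thus realises the defaults `[].headI = 0` and `[].tail = []` without a case distinction.
-/
theorem RepList.lookup {L : List (ℕ × ℕ × ℕ)} {v : List ℕ} {s : ℕ} (hs : RepList L v s) :
    ∃ a d, L.lookup s = some (a, d) ∧ RepNat L v.headI a ∧ RepList L v.tail d := by
  cases v with
  | nil => exact ⟨s, s, hs, hs, hs⟩
  | cons n v => exact hs

/-- The self-loop at zero matches `Nat.pred 0 = 0`; the condition `a ≠ s` for successors makes
comparison of a symbol with its first component a zero test. -/
theorem RepNat.lookup {L : List (ℕ × ℕ × ℕ)} {n s : ℕ} (hs : RepNat L n s) :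
    ∃ a d, L.lookup s = some (a, d) ∧ RepNat L n.pred a ∧ (s = a ↔ n = 0) := by
  cases n with
  | zero => exact ⟨s, s, hs, hs, by simp⟩
  | succ n =>
    obtain ⟨a, d, e, hne, ha⟩ := hs
    exact ⟨a, d, e, ha, by simp [hne.symm]⟩

/-- The zero test on a number. -/
theorem RepNat.isZero {L : List (ℕ × ℕ × ℕ)} {n s : ℕ} (hs : RepNat L n s) {M : Tm}
    (hM : FailEquiv M (.label s)) :
    FailEquiv (.symEq M (.app (.app (heapTm L) M) (.bool true))) (.bool (decide (n = 0))) := by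
  obtain ⟨a, d, e, -, hz⟩ := hs.lookup
  have := FailEquiv.symEq hM (heapTm_lookup e hM true)
  simpa [hz] using this

/-! ### Allocation -/

/-- Allocation of a cell with given components. -/
def consTm : Tm :=
  .lam (.lam (.lam (.lam (.app (.lam (.app (.app (.var 1) (.var 0))
    (.lam (.lam (.cond (.symEq (.var 1) (.var 2)) (.cond (.var 0) (.var 6) (.var 5))
      (.app (.app (.var 4) (.var 1)) (.var 0))))))) .gensym))))

/-- Allocation of a cell that represents zero and the empty list. -/
def nilTm : Tm :=
  .lam (.lam (.app (.lam (.app (.app (.var 1) (.var 0))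
    (.lam (.lam (.cond (.symEq (.var 1) (.var 2)) (.cond (.var 0) (.var 2) (.var 2))
      (.app (.app (.var 4) (.var 1)) (.var 0))))))) .gensym))

theorem consTm_typed : Typed [] consTm
    (.arrow .sym (.arrow .sym (.arrow heapTy (.arrow contTy (.base .unit))))) := by
  unfold consTm
  repeat' first | exact .var rfl | exact .bool | exact .gensym | apply Typed.lam | apply Typed.app |
    apply Typed.cond | apply Typed.symEq

theorem nilTm_typed : Typed [] nilTm (.arrow heapTy (.arrow contTy (.base .unit))) := by
  unfold nilTm
  repeat' first | exact .var rfl | exact .bool | exact .gensym | apply Typed.lam | apply Typed.app |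
    apply Typed.cond | apply Typed.symEq

theorem Typed.closed {M : Tm} {τ : Ty} (h : Typed [] M τ) : M.Closed :=
  h.closedAt

@[simp]
theorem consTm_subst (σ : ℕ → Tm) : consTm.subst σ = consTm :=
  consTm_typed.closed.subst σ

@[simp]
theorem nilTm_subst (σ : ℕ → Tm) : nilTm.subst σ = nilTm :=
  nilTm_typed.closed.subst σ

/-- After evaluation of `A` and `D`, the body is a `gensym` binding to which
`reachesFail_let_gensym` applies. The new function handed to `k` is literally the heap expression
with one more entry. -/
theorem reachesFail_consTm {L : List (ℕ × ℕ × ℕ)} {a d : ℕ} {A D k : Tm}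
    (hA : FailEquiv A (.label a)) (hD : FailEquiv D (.label d)) (hv : IsValue k)
    (hc : k.Closed) {P : Prop}
    (h : ∀ s, L.lookup s = none →
      (ReachesFail (.app (.app k (.label s)) (heapTm ((s, a, d) :: L))) ↔ P)) :
    ReachesFail (.app (.app (.app (.app consTm A) D) (heapTm L)) k) ↔ P := by
  have hAD : FailEquiv (.app (.app consTm A) D) (.app (.app consTm (.label a)) (.label d)) :=
    ((hA.appR (.lam _)).appL D).trans (hD.appR_of_isValue (FailEquiv.beta _ (.label a)) (.lam _))
  refine ((hAD.appL _).appL _).iff.trans ?_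
  refine (FailEquiv.beta₄ _ (.label a) (.label d) (heapTm_isValue L) hv).iff.trans ?_
  simp only [Tm.subst, upSub, single, Tm.rename, heapTm_subst, heapTm_rename, hc.rename]
  refine reachesFail_let_gensym fun s hs => ?_
  have := h s (lookup_eq_none_of_not_occurs fun ho => hs (by simp [Tm.Occurs, ho]))
  simpa [Tm.inst, Tm.subst, upSub, single, Tm.rename, hc.subst, heapTm] using this

theorem reachesFail_consTm_list {L : List (ℕ × ℕ × ℕ)} {a d n : ℕ} {v : List ℕ}
    (ha : RepNat L n a) (hd : RepList L v d) {A D k : Tm} (hA : FailEquiv A (.label a))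
    (hD : FailEquiv D (.label d)) (hv : IsValue k) (hc : k.Closed) {P : Prop}
    (h : ∀ s L', HeapLE L L' → RepList L' (n :: v) s →
      (ReachesFail (.app (.app k (.label s)) (heapTm L')) ↔ P)) :
    ReachesFail (.app (.app (.app (.app consTm A) D) (heapTm L)) k) ↔ P :=
  reachesFail_consTm hA hD hv hc fun s hs =>
    have hle := HeapLE.cons hs (a, d)
    h s _ hle ⟨a, d, by simp, ha.mono hle, hd.mono hle⟩

theorem reachesFail_consTm_succ {L : List (ℕ × ℕ × ℕ)} {a n : ℕ}
    (ha : RepNat L n a) {A k : Tm} (hA : FailEquiv A (.label a))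
    (hv : IsValue k) (hc : k.Closed) {P : Prop}
    (h : ∀ s L', HeapLE L L' → RepNat L' (n + 1) s →
      (ReachesFail (.app (.app k (.label s)) (heapTm L')) ↔ P)) :
    ReachesFail (.app (.app (.app (.app consTm A) A) (heapTm L)) k) ↔ P := by
  refine reachesFail_consTm hA hA hv hc fun s hs => ?_
  have hle := HeapLE.cons hs (a, a)
  refine h s _ hle ⟨a, a, by simp, ?_, ha.mono hle⟩
  -- The new symbol differs from `a` because `a` already has a cell in `L`.
  rintro rfl
  obtain ⟨b, d, e, -⟩ := ha.lookup
  simp [hs] at e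

theorem reachesFail_nilTm {L : List (ℕ × ℕ × ℕ)} {k : Tm} (hv : IsValue k)
    (hc : k.Closed) {P : Prop}
    (h : ∀ s L', HeapLE L L' → RepNat L' 0 s → RepList L' [] s →
      (ReachesFail (.app (.app k (.label s)) (heapTm L')) ↔ P)) :
    ReachesFail (.app (.app nilTm (heapTm L)) k) ↔ P := by
  refine (FailEquiv.beta₂ _ (heapTm_isValue L) hv).iff.trans ?_
  simp only [Tm.subst, upSub, single, Tm.rename, heapTm_subst, heapTm_rename, hc.rename]
  refine reachesFail_let_gensym fun s hs => ?_
  have hn := lookup_eq_none_of_not_occurs (L := L) (l := s) fun ho => hs (by simp [Tm.Occurs, ho])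
  have := h s ((s, s, s) :: L) (.cons hn _) (by simp [RepNat]) (by simp [RepList])
  simpa [Tm.inst, Tm.subst, upSub, single, Tm.rename, hc.subst, heapTm] using this

open Turing.ToPartrec

/-! ### Compilation of partial recursive functions -/

/-- The expression for the component `b` of the cell `s` of the heap `h`. -/
abbrev getTm (h s : Tm) (b : Bool) : Tm :=
  .app (.app h s) (.bool b)

/-- The test whether the head of the list `s` in the heap `h` is zero. -/
abbrev headIsZeroTm (h s : Tm) : Tm :=
  .symEq (getTm h s true) (getTm h (getTm h s true) true)

/-- The body of the recursive function that iterates the program `F` until it returns a list with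
head zero. -/
def loopTm (F : Tm) : Tm :=
  .lam (.lam (.app (.app (.app F (.var 2)) (.var 1))
    (.lam (.lam (.cond (headIsZeroTm (.var 0) (.var 1))
      (.app (.app (.var 2) (getTm (.var 0) (.var 1) false)) (.var 0))
      (.app (.app (.app (.var 5) (getTm (.var 0) (.var 1) false)) (.var 0)) (.var 2)))))))

/-- The program, in continuation-passing style, that computes a partial recursive function on
lists of numbers. -/
def compile : Code → Tm
  | .zero' => .lam (.lam (.lam (.app (.app nilTm (.var 1))
      (.lam (.lam (.app (.app (.app (.app consTm (.var 1)) (.var 4)) (.var 0)) (.var 2)))))))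
  | .succ => .lam (.lam (.lam (.app (.app (.app (.app consTm (getTm (.var 1) (.var 2) true))
      (getTm (.var 1) (.var 2) true)) (.var 1))
        (.lam (.lam (.app (.app nilTm (.var 0))
          (.lam (.lam (.app (.app (.app (.app consTm (.var 3)) (.var 1)) (.var 0)) (.var 4))))))))))
  | .tail => .lam (.lam (.lam (.app (.app (.var 0) (getTm (.var 1) (.var 2) false)) (.var 1))))
  | .cons f fs => .lam (.lam (.lam (.app (.app (.app (compile f) (.var 2)) (.var 1))
      (.lam (.lam (.app (.app (.app (compile fs) (.var 4)) (.var 0))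
        (.lam (.lam (.app (.app (.app (.app consTm (getTm (.var 0) (.var 3) true)) (.var 1))
          (.var 0)) (.var 4))))))))))
  | .comp f g => .lam (.lam (.lam (.app (.app (.app (compile g) (.var 2)) (.var 1))
      (.lam (.lam (.app (.app (.app (compile f) (.var 1)) (.var 0)) (.var 2)))))))
  | .case f g => .lam (.lam (.lam (.cond (headIsZeroTm (.var 1) (.var 2))
      (.app (.app (.app (compile f) (getTm (.var 1) (.var 2) false)) (.var 1)) (.var 0))
      (.app (.app (.app (.app consTm (getTm (.var 1) (getTm (.var 1) (.var 2) true) true))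
        (getTm (.var 1) (.var 2) false)) (.var 1))
        (.lam (.lam (.app (.app (.app (compile g) (.var 1)) (.var 0)) (.var 2))))))))
  | .fix f => .fix (loopTm (compile f))

theorem compile_typed (c : Code) : Typed [] (compile c) progTy := by
  induction c <;> simp only [compile, loopTm] <;>
  repeat' first | exact .var rfl | exact .bool | exact consTm_typed.of_nil _ |
    exact nilTm_typed.of_nil _ | exact Typed.of_nil ‹_› _ | apply Typed.lam | apply Typed.app |
    apply Typed.cond | apply Typed.symEq | apply Typed.fix

@[simp]
theorem compile_subst (c : Code) (σ : ℕ → Tm) : (compile c).subst σ = compile c :=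
  (compile_typed c).closed.subst σ

/-- Only `fix` is not yet a value, and one unfolding makes it a lambda. This licenses evaluating an
argument to which a compiled program is applied. -/
theorem compile_evaluates (c : Code) : ∃ V, IsValue V ∧ FailEquiv (compile c) V := by
  cases c with
  | fix f => exact ⟨_, .lam _, (Contracts.fix _).failEquiv⟩
  | _ => exact ⟨_, .lam _, .refl _⟩

/-- The program `F` returns a representation of `v'` on every representation of `v`. -/
def Computes (F : Tm) (v v' : List ℕ) : Prop :=
  ∀ (L : List (ℕ × ℕ × ℕ)) (s : ℕ), RepList L v s → ∀ k : Tm, IsValue k → k.Closed → ∀ P : Prop,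
    (∀ s' L', HeapLE L L' → RepList L' v' s' →
      (ReachesFail (.app (.app k (.label s')) (heapTm L')) ↔ P)) →
    (ReachesFail (.app (.app (.app F (.label s)) (heapTm L)) k) ↔ P)

/-! ### Correctness of the compilation on terminating runs -/

theorem computes_zero' (v : List ℕ) : Computes (compile .zero') v (0 :: v) := by
  intro L s hs k hv hc P h
  refine (FailEquiv.beta₃ _ (.label s) (heapTm_isValue L) hv).iff.trans ?_
  simp only [Tm.subst, upSub, single, Tm.rename, heapTm_subst, heapTm_rename, hc.rename, consTm_subst,
    nilTm_subst]
  refine reachesFail_nilTm (.lam _) ?_ fun n L₁ h₁ hn _ => ?_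
  · simp [Tm.Closed, Tm.ClosedAt, hc.closedAt, consTm_typed.closed.closedAt]
  refine (FailEquiv.beta₂ _ (.label n) (heapTm_isValue L₁)).iff.trans ?_
  simp only [Tm.subst, upSub, single, Tm.rename, hc.subst, consTm_subst]
  exact reachesFail_consTm_list hn (hs.mono h₁) (.refl _) (.refl _) hv hc
    fun s' L' h₂ hs' => h s' L' (h₁.trans h₂) hs'

theorem computes_succ (v : List ℕ) : Computes (compile .succ) v [v.headI.succ] := by
  intro L s hs k hv hc P h
  obtain ⟨a, d, e, ha, hd⟩ := hs.lookup
  refine (FailEquiv.beta₃ _ (.label s) (heapTm_isValue L) hv).iff.trans ?_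
  simp only [Tm.subst, upSub, single, Tm.rename, heapTm_subst, heapTm_rename, hc.rename, consTm_subst,
    nilTm_subst]
  refine reachesFail_consTm_succ ha (heapTm_lookup e (.refl _) true) (.lam _) ?_
    fun n L₁ h₁ hn => ?_
  · simp [Tm.Closed, Tm.ClosedAt, hc.closedAt, consTm_typed.closed.closedAt,
      nilTm_typed.closed.closedAt]
  refine (FailEquiv.beta₂ _ (.label n) (heapTm_isValue L₁)).iff.trans ?_
  simp only [Tm.subst, upSub, single, Tm.rename, hc.subst, consTm_subst,
    nilTm_subst]
  refine reachesFail_nilTm (.lam _) ?_ fun z L₂ h₂ _ hz => ?_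
  · simp [Tm.Closed, Tm.ClosedAt, hc.closedAt, consTm_typed.closed.closedAt]
  refine (FailEquiv.beta₂ _ (.label z) (heapTm_isValue L₂)).iff.trans ?_
  simp only [Tm.subst, upSub, single, Tm.rename, hc.subst, consTm_subst]
  exact reachesFail_consTm_list (hn.mono h₂) hz (.refl _) (.refl _) hv hc
    fun s' L' h₃ hs' => h s' L' ((h₁.trans h₂).trans h₃) hs'

theorem computes_tail (v : List ℕ) : Computes (compile .tail) v v.tail := by
  intro L s hs k hv hc P h
  obtain ⟨a, d, e, ha, hd⟩ := hs.lookup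
  refine (FailEquiv.beta₃ _ (.label s) (heapTm_isValue L) hv).iff.trans ?_
  simp only [Tm.subst, upSub, single, Tm.rename, heapTm_subst, heapTm_rename]
  exact (((heapTm_lookup e (.refl _) false).appR hv).appL _).iff.trans (h d L (.refl L) hd)

theorem Computes.cons {f fs : Code} {v v₁ v₂ : List ℕ} (hf : Computes (compile f) v v₁)
    (hfs : Computes (compile fs) v v₂) :
    Computes (compile (.cons f fs)) v (v₁.headI :: v₂) := by
  intro L s hs k hv hc P h
  refine (FailEquiv.beta₃ _ (.label s) (heapTm_isValue L) hv).iff.trans ?_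
  simp only [Tm.subst, upSub, single, Tm.rename, heapTm_subst, heapTm_rename, hc.rename, consTm_subst,
    compile_subst]
  refine hf L s hs _ (.lam _) ?_ P fun r L₁ h₁ hr => ?_
  · simp [Tm.Closed, Tm.ClosedAt, hc.closedAt, consTm_typed.closed.closedAt,
      (compile_typed _).closed.closedAt]
  refine (FailEquiv.beta₂ _ (.label r) (heapTm_isValue L₁)).iff.trans ?_
  simp only [Tm.subst, upSub, single, Tm.rename, hc.subst, consTm_subst,
    compile_subst]
  -- The second program reuses the original input `s`, which survives the first run because heaps
  -- only grow.
  refine hfs L₁ s (hs.mono h₁) _ (.lam _) ?_ P fun rs L₂ h₂ hrs => ?_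
  · simp [Tm.Closed, Tm.ClosedAt, hc.closedAt, consTm_typed.closed.closedAt]
  refine (FailEquiv.beta₂ _ (.label rs) (heapTm_isValue L₂)).iff.trans ?_
  simp only [Tm.subst, upSub, single, Tm.rename, hc.subst, consTm_subst]
  obtain ⟨a, d, e, ha, -⟩ := (hr.mono h₂).lookup
  exact reachesFail_consTm_list ha hrs (heapTm_lookup e (.refl _) true) (.refl _) hv hc
    fun s' L' h₃ hs' => h s' L' ((h₁.trans h₂).trans h₃) hs'

theorem Computes.comp {f g : Code} {v v₁ v₂ : List ℕ} (hf : Computes (compile f) v₁ v₂)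
    (hg : Computes (compile g) v v₁) : Computes (compile (.comp f g)) v v₂ := by
  intro L s hs k hv hc P h
  refine (FailEquiv.beta₃ _ (.label s) (heapTm_isValue L) hv).iff.trans ?_
  simp only [Tm.subst, upSub, single, Tm.rename, heapTm_subst, heapTm_rename, hc.rename,
    compile_subst]
  refine hg L s hs _ (.lam _) ?_ P fun r L₁ h₁ hr => ?_
  · simp [Tm.Closed, Tm.ClosedAt, hc.closedAt, (compile_typed _).closed.closedAt]
  refine (FailEquiv.beta₂ _ (.label r) (heapTm_isValue L₁)).iff.trans ?_
  simp only [Tm.subst, upSub, single, Tm.rename, hc.subst,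
    compile_subst]
  exact hf L₁ r hr k hv hc P fun s' L' h₂ hs' => h s' L' (h₁.trans h₂) hs'

theorem headIsZeroTm_equiv {L : List (ℕ × ℕ × ℕ)} {v : List ℕ} {s : ℕ} (hs : RepList L v s) :
    FailEquiv (headIsZeroTm (heapTm L) (.label s)) (.bool (decide (v.headI = 0))) := by
  obtain ⟨a, d, e, ha, -⟩ := hs.lookup
  exact ha.isZero (heapTm_lookup e (.refl _) true)

theorem Computes.case_zero {f g : Code} {v v' : List ℕ} (h0 : v.headI = 0)
    (hf : Computes (compile f) v.tail v') : Computes (compile (.case f g)) v v' := by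
  intro L s hs k hv hc P h
  obtain ⟨a, d, e, ha, hd⟩ := hs.lookup
  refine (FailEquiv.beta₃ _ (.label s) (heapTm_isValue L) hv).iff.trans ?_
  simp only [Tm.subst, upSub, single, Tm.rename, heapTm_subst, heapTm_rename, hc.rename,
    compile_subst, consTm_subst]
  refine (((headIsZeroTm_equiv hs).cond _ _).trans (.cond_bool _ _ _)).iff.trans ?_
  simp only [h0, decide_true, cond_true]
  obtain ⟨V, hV, hF⟩ := compile_evaluates f
  refine ((((heapTm_lookup e (.refl _) false).appR_of_isValue hF hV).appL _).appL _).iff.trans ?_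
  exact hf L d hd k hv hc P h

theorem Computes.case_succ {f g : Code} {v v' : List ℕ} {n : ℕ} (hn : v.headI = n + 1)
    (hg : Computes (compile g) (n :: v.tail) v') : Computes (compile (.case f g)) v v' := by
  intro L s hs k hv hc P h
  obtain ⟨a, d, e, ha, hd⟩ := hs.lookup
  obtain ⟨a', d', e', ha', -⟩ := ha.lookup
  rw [hn] at ha'
  refine (FailEquiv.beta₃ _ (.label s) (heapTm_isValue L) hv).iff.trans ?_
  simp only [Tm.subst, upSub, single, Tm.rename, heapTm_subst, heapTm_rename, hc.rename,
    compile_subst, consTm_subst]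
  refine (((headIsZeroTm_equiv hs).cond _ _).trans (.cond_bool _ _ _)).iff.trans ?_
  simp only [hn, Nat.add_one_ne_zero, decide_false, cond_false]
  -- The predecessor is the first component of the head's cell; it is consed onto the tail to form
  -- the input of `g`.
  refine reachesFail_consTm_list ha' hd (heapTm_lookup e' (heapTm_lookup e (.refl _) true) true)
    (heapTm_lookup e (.refl _) false) (.lam _) ?_ fun r L₁ h₁ hr => ?_
  · simp [Tm.Closed, Tm.ClosedAt, hc.closedAt, (compile_typed _).closed.closedAt]
  refine (FailEquiv.beta₂ _ (.label r) (heapTm_isValue L₁)).iff.trans ?_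
  simp only [Tm.subst, upSub, single, Tm.rename, hc.subst,
    compile_subst]
  exact hg L₁ r hr k hv hc P fun s' L' h₂ hs' => h s' L' (h₁.trans h₂) hs'

/-- One round of the loop of `compile (.fix f)`. -/
theorem Computes.fix_step {f : Code} {v v₁ v' : List ℕ} (hf : Computes (compile f) v v₁)
    (h' : if v₁.headI = 0 then v' = v₁.tail else Computes (compile (.fix f)) v₁.tail v') :
    Computes (compile (.fix f)) v v' := by
  intro L s hs k hv hc P h
  have hF : (compile (.fix f)).Closed := (compile_typed _).closed
  have hfix : FailEquiv (compile (.fix f))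
      ((Tm.lam (loopTm (compile f))).inst (compile (.fix f))) := (Contracts.fix _).failEquiv
  refine (((hfix.appL _).appL _).appL _).iff.trans ?_
  refine (FailEquiv.beta₃ _ (.label s) (heapTm_isValue L) hv).iff.trans ?_
  simp only [Tm.subst, upSub, single, Tm.rename, heapTm_subst, heapTm_rename, hc.rename,
    compile_subst, hF.rename]
  refine hf L s hs _ (.lam _) ?_ P fun r L₁ h₁ hr => ?_
  · simp [Tm.Closed, Tm.ClosedAt, hc.closedAt, (compile_typed _).closed.closedAt]
  obtain ⟨a, d, e, ha, hd⟩ := hr.lookup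
  refine (FailEquiv.beta₂ _ (.label r) (heapTm_isValue L₁)).iff.trans ?_
  simp only [Tm.subst, upSub, single, Tm.rename, hc.subst,
    compile_subst]
  refine (((headIsZeroTm_equiv hr).cond _ _).trans (.cond_bool _ _ _)).iff.trans ?_
  have hget := heapTm_lookup e (.refl _) false
  split_ifs at h' with h0
  · subst h'
    simp only [h0, decide_true, cond_true]
    exact ((hget.appR hv).appL _).iff.trans (h d L₁ h₁ hd)
  · simp only [h0, decide_false, cond_false]
    -- The recursive call is again an unevaluated `fix`, so its argument can be computed only after
    -- unfolding it.
    refine (((hget.appR_of_isValue hfix (.lam _)).appL _).appL _).iff.trans ?_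
    exact h' L₁ d hd k hv hc P fun s' L' h₂ hs' => h s' L' (h₁.trans h₂) hs'

theorem compile_computes (c : Code) {v v' : List ℕ} (h : v' ∈ c.eval v) :
    Computes (compile c) v v' := by
  induction c generalizing v v' with
  | zero' =>
    simp only [Code.zero'_eval, Part.pure_eq_some, Part.mem_some_iff] at h
    exact h ▸ computes_zero' v
  | succ =>
    simp only [Code.succ_eval, Part.pure_eq_some, Part.mem_some_iff] at h
    exact h ▸ computes_succ v
  | tail =>
    simp only [Code.tail_eval, Part.pure_eq_some, Part.mem_some_iff] at h
    exact h ▸ computes_tail v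
  | cons f fs ihf ihfs =>
    simp only [Code.cons_eval, Part.bind_eq_bind, Part.mem_bind_iff, Part.pure_eq_some,
      Part.mem_some_iff] at h
    obtain ⟨v₁, h₁, v₂, h₂, rfl⟩ := h
    exact (ihf h₁).cons (ihfs h₂)
  | comp f g ihf ihg =>
    rw [Code.comp_eval] at h
    obtain ⟨v₁, h₁, h₂⟩ := Part.mem_bind_iff.1 h
    exact (ihf h₂).comp (ihg h₁)
  | case f g ihf ihg =>
    simp only [Code.case_eval] at h
    cases hn : v.headI with
    | zero =>
      rw [hn] at h
      exact .case_zero hn (ihf h)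
    | succ n =>
      rw [hn] at h
      exact .case_succ hn (ihg h)
  | fix f ih =>
    rw [Code.fix_eval] at h
    -- Membership of `v'` in the result means finitely many rounds, so induction along the rounds
    -- applies, each handled by `fix_step`.
    refine PFun.fixInduction' (C := fun v => Computes _ v v') h (fun v hv => ?_)
      fun v w _ hv hw => ?_
    all_goals
      simp only [Part.mem_map_iff] at hv
      obtain ⟨v₁, h₁, e⟩ := hv
      refine (ih h₁).fix_step ?_
      split_ifs at e ⊢ with h0
    · exact (Sum.inl.inj e).symm
    · exact Sum.inr.inj e ▸ hw

/-! ### The reduction -/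

/-- Allocation of a representation of `n`. -/
def numeralTm : ℕ → Tm
  | 0 => nilTm
  | n + 1 => .lam (.lam (.app (.app (numeralTm n) (.var 1))
      (.lam (.lam (.app (.app (.app (.app consTm (.var 1)) (.var 1)) (.var 0)) (.var 2))))))

theorem numeralTm_typed (n : ℕ) :
    Typed [] (numeralTm n) (.arrow heapTy (.arrow contTy (.base .unit))) := by
  induction n with
  | zero => exact nilTm_typed
  | succ n ih =>
    unfold numeralTm
    repeat' first | exact .var rfl | exact consTm_typed.of_nil _ | exact Typed.of_nil ih _ |
      apply Typed.lam | apply Typed.app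

theorem reachesFail_numeralTm (n : ℕ) {L : List (ℕ × ℕ × ℕ)} {k : Tm} (hv : IsValue k)
    (hc : k.Closed) {P : Prop}
    (h : ∀ s L', HeapLE L L' → RepNat L' n s →
      (ReachesFail (.app (.app k (.label s)) (heapTm L')) ↔ P)) :
    ReachesFail (.app (.app (numeralTm n) (heapTm L)) k) ↔ P := by
  induction n generalizing k L with
  | zero => exact reachesFail_nilTm hv hc fun s L' h₁ hs _ => h s L' h₁ hs
  | succ n ih =>
    refine (FailEquiv.beta₂ _ (heapTm_isValue L) hv).iff.trans ?_
    simp only [Tm.subst, upSub, single, Tm.rename, heapTm_subst, heapTm_rename, hc.rename,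
      consTm_subst, (numeralTm_typed n).closed.subst]
    refine ih (.lam _) ?_ fun s L₁ h₁ hs => ?_
    · simp [Tm.Closed, Tm.ClosedAt, hc.closedAt, consTm_typed.closed.closedAt]
    refine (FailEquiv.beta₂ _ (.label s) (heapTm_isValue L₁)).iff.trans ?_
    simp only [Tm.subst, upSub, single, Tm.rename, hc.subst, consTm_subst]
    exact reachesFail_consTm_succ hs (.refl _) hv hc fun s' L' h₂ hs' => h s' L' (h₁.trans h₂) hs'

/-- The continuation that fails if the head of the result is zero. -/
def finalTm : Tm :=
  .lam (.lam (.cond (headIsZeroTm (.var 0) (.var 1)) .fail .unit))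

/-- The continuation that runs `compile c` on the list whose only entry is the given number. -/
def runTm (c : Code) : Tm :=
  .lam (.lam (.app (.app nilTm (.var 0))
    (.lam (.lam (.app (.app (.app (.app consTm (.var 3)) (.var 1)) (.var 0))
      (.lam (.lam (.app (.app (.app (compile c) (.var 1)) (.var 0)) finalTm))))))))

/-- The closed expression that fails if `c` returns zero on `[n]`, and that returns the unit value
if `c` returns another number. -/
def reductionTm (c : Code) (n : ℕ) : Tm :=
  .app (.app (numeralTm n) (heapTm [])) (runTm c)

theorem finalTm_typed : Typed [] finalTm contTy := by
  unfold finalTm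
  repeat' first | exact .var rfl | exact .bool | exact .fail | exact .unit | apply Typed.lam |
    apply Typed.app | apply Typed.cond | apply Typed.symEq

theorem runTm_typed (c : Code) : Typed [] (runTm c) contTy := by
  unfold runTm
  repeat' first | exact .var rfl | exact consTm_typed.of_nil _ | exact nilTm_typed.of_nil _ |
    exact (compile_typed c).of_nil _ | exact finalTm_typed.of_nil _ | apply Typed.lam |
    apply Typed.app

theorem reductionTm_typed (c : Code) (n : ℕ) :
    Typed [] (reductionTm c n) (.base .unit) :=
  .app (.app (numeralTm_typed n) (.lam (.lam (.var rfl)))) (runTm_typed c)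

theorem reachesFail_finalTm {L : List (ℕ × ℕ × ℕ)} {v : List ℕ} {s : ℕ} (hs : RepList L v s) :
    ReachesFail (.app (.app finalTm (.label s)) (heapTm L)) ↔ v.headI = 0 := by
  refine (FailEquiv.beta₂ _ (.label s) (heapTm_isValue L)).iff.trans ?_
  simp only [Tm.subst, upSub, single, Tm.rename]
  refine (((headIsZeroTm_equiv hs).cond _ _).trans (.cond_bool _ _ _)).iff.trans ?_
  by_cases h0 : v.headI = 0
  · simpa [h0, ReachesFail] using Relation.ReflTransGen.refl
  · simpa [h0] using not_reachesFail_unit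

/-- The proposition `P` of `Computes` is instantiated with `v.headI = 0`, which the final
continuation decides for every representation of the result. -/
theorem reachesFail_reductionTm {c : Code} {n : ℕ} {v : List ℕ} (h : v ∈ c.eval [n]) :
    ReachesFail (reductionTm c n) ↔ v.headI = 0 := by
  refine reachesFail_numeralTm n (.lam _) (runTm_typed c).closed fun s L _ hs => ?_
  refine (FailEquiv.beta₂ _ (.label s) (heapTm_isValue L)).iff.trans ?_
  simp only [Tm.subst, upSub, single, Tm.rename, consTm_subst, nilTm_subst, compile_subst,
    finalTm_typed.closed.subst]
  refine reachesFail_nilTm (.lam _) ?_ fun e L₁ h₁ _ he => ?_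
  · simp [Tm.Closed, Tm.ClosedAt, consTm_typed.closed.closedAt, (compile_typed c).closed.closedAt,
      finalTm_typed.closed.closedAt]
  refine (FailEquiv.beta₂ _ (.label e) (heapTm_isValue L₁)).iff.trans ?_
  simp only [Tm.subst, upSub, single, Tm.rename, consTm_subst, compile_subst,
    finalTm_typed.closed.subst]
  refine reachesFail_consTm_list (hs.mono h₁) he (.refl _) (.refl _) (.lam _) ?_
    fun l L₂ _ hl => ?_
  · simp [Tm.Closed, Tm.ClosedAt, (compile_typed c).closed.closedAt,
      finalTm_typed.closed.closedAt]
  refine (FailEquiv.beta₂ _ (.label l) (heapTm_isValue L₂)).iff.trans ?_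
  simp only [Tm.subst, upSub, single, compile_subst, finalTm_typed.closed.subst, Tm.rename]
  exact compile_computes c h L₂ l hl finalTm (.lam _) finalTm_typed.closed _
    fun _ _ _ hs' => reachesFail_finalTm hs'

/-! ### Computability of the reduction and the diagonal function -/

theorem primrec_numeralTm_code : Primrec fun n => (numeralTm n).code := by
  -- The code of each numeral comes from the previous one by pairing with constants; 4 and 5 are the
  -- tags of `lam` and `app`.
  have hstep : Primrec₂ fun (_ m : ℕ) => Nat.pair 4 (Nat.pair 4 (Nat.pair 5 (Nat.pair
      (Nat.pair 5 (Nat.pair m (Tm.var 1).code))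
      (Tm.lam (.lam (.app (.app (.app (.app consTm (.var 1)) (.var 1)) (.var 0)) (.var 2)))).code))) :=
    Primrec₂.natPair.comp (.const 4) <| Primrec₂.natPair.comp (.const 4) <|
      Primrec₂.natPair.comp (.const 5) <| Primrec₂.natPair.comp
        (Primrec₂.natPair.comp (.const 5) (Primrec₂.natPair.comp .snd (.const _))) (.const _)
  refine (Primrec.nat_rec₁ nilTm.code hstep).of_eq fun n => ?_
  induction n with
  | zero => rfl
  | succ n ih =>
    simp only [numeralTm, Tm.code] at ih ⊢
    rw [ih]

theorem primrec_reductionTm_code (c : Code) : Primrec fun n => (reductionTm c n).code :=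
  Primrec₂.natPair.comp (.const 5) <| Primrec₂.natPair.comp
    (Primrec₂.natPair.comp (.const 5) (Primrec₂.natPair.comp primrec_numeralTm_code (.const _)))
    (.const _)

/-- A partial recursive function whose value at `e` differs, as to being zero, from that of the
function with code `e`. -/
def diagonal (e : ℕ) : Part ℕ :=
  -- Truncated subtraction sends 0 to 1 and every positive number to 0.
  (Nat.Partrec.Code.eval (Denumerable.ofNat Nat.Partrec.Code e) e).map fun x => 1 - x

theorem diagonal_partrec : Partrec diagonal :=
  (Nat.Partrec.Code.eval_part.comp (Computable.ofNat _) Computable.id).map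
    (Primrec.nat_sub.comp (.const 1) .snd).to_comp.to₂

theorem exists_code_diagonal :
    ∃ c : Code, ∀ n, ∀ x ∈ diagonal n, [x] ∈ c.eval [n] := by
  obtain ⟨c, hc⟩ := Code.exists_code (Nat.Partrec'.part_iff₁.2 diagonal_partrec)
  refine ⟨c, fun n x hx => ?_⟩
  have := hc (n ::ᵥ .nil)
  simp only [List.Vector.head_cons] at this
  change c.eval [n] = _ at this
  rw [this]
  exact Part.mem_map _ hx

end BPCFL

theorem mainTheorem3 : ¬ ∃ f : ℕ →. Bool, Partrec f ∧ BPCFL.SolvesReachability f := by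
  rintro ⟨f, hf, hsolve⟩
  obtain ⟨c, hc⟩ := BPCFL.exists_code_diagonal
  have hg : Partrec fun n => (f (BPCFL.reductionTm c n).code).map fun r => cond r 0 1 :=
    (hf.comp (BPCFL.primrec_reductionTm_code c).to_comp).map
      (Primrec.cond .snd (.const 0) (.const 1)).to_comp.to₂
  -- `d` computes 0 where `f` announces failure and 1 where it denies it; the argument then
  -- evaluates `f` at the instance given by the code of `d`.
  obtain ⟨d, hd⟩ := Nat.Partrec.Code.exists_code.1 (Partrec.nat_iff.1 hg)
  set e := Encodable.encode d with he
  obtain ⟨r, hr, hrf⟩ := hsolve _ _ (BPCFL.reductionTm_typed c e)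
  -- Since the expression is well typed, `f` answers on it, so the diagonal function is defined at
  -- `e` and `c` terminates on `[e]`.
  have hdiag : 1 - cond r 0 1 ∈ BPCFL.diagonal e := by
    refine Part.mem_map _ ?_
    rw [he, Denumerable.ofNat_encode, hd]
    exact Part.mem_map _ hr
  rw [BPCFL.reachesFail_reductionTm (hc e _ hdiag)] at hrf
  -- The answer `true` makes the diagonal value 1, so `fail` is not reached; the answer `false`
  -- makes it 0, so `fail` is reached.
  cases r <;> simp at hrf
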